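/- Let $d\in\{2,3\}$, let $\mathcal G=(\mathcal V,\mathcal E)$ be a finite simple undirected graph on $\mathcal V=\{1,\dots,n\}$ with $m$ edges, numbered $1,\dots,m$ and directed arbitrarily, and let $H\in\mathbb R^{m\times n}$ be its incidence matrix ($h_{ki}=1$ if edge $k$ sinks at $i$, $h_{ki}=-1$ if edge $k$ leaves $i$, and $h_{ki}=0$ otherwise). For $p=[p_1^T,\dots,p_n^T]^T\in\mathbb R^{dn}$ put $z=(H\otimes I_d)p$, $Z=\mathrm{diag}(z_1,\dots,z_m)\in\mathbb R^{dm\times m}$ and $R(p)=Z^T(H\otimes I_d)$ (the rigidity matrix). The framework $(\mathcal G,p)$ is called infinitesimally rigid in $\mathbb R^d$ if $n\ge d$ and $\operatorname{rank}R(p)=dn-d(d+1)/2$. Let $\mathcal G_o=(\mathcal V,\mathcal E_o)$ be the graph of orientation edges, $L_o$ its Laplacian matrix, let $d_1,\dots,d_m$ be desired distances of the edges of $\mathcal G$, and let $\hat p\in\mathbb R^{dn}$. Let $\tilde p\in\mathbb R^{dn}$ be a target formation, i.e. $\|\tilde p_i-\tilde p_j\|=d_k$ for every edge $k=(i,j)\in\mathcal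 E$ and $\tilde p_i-\tilde p_j=\hat p_i-\hat p_j$ for all $(i,j)\in\mathcal E_o$. Assume that $(\mathcal G,\tilde p)$ is infinitesimally rigid and that the orientation edges are chosen as follows: if $d=2$, $\mathcal E_o$ consists of one edge $(i,j)\in\mathcal E$ with $\tilde p_j\ne\tilde p_i$; if $d=3$, $\mathcal E_o$ consists of two edges $(i,j),(i,k)\in\mathcal E$ with a common endpoint $i$ for which $\tilde p_j-\tilde p_i$ and $\tilde p_k-\tilde p_i$ are linearly independent. Consider the closed-loop system $$\dot p=-R(p)^Te(p)-(L_o\otimes I_d)\,\bar p,$$ where $e_k(p)=\|p_i-p_j\|^2-d_k^2$ for each edge $k=(i,j)$, $\bar p_i=p_i-\hat p_i$ if $i$ is an endpoint of an edge in $\mathcal E_o$, and $\bar p_i=0$ otherwise. Let $$\mathcal M=\{p\in\mathbb R^{dn}: e(p)=0,\ p_i-p_j=\hat p_i-\hat p_j\ \ \forall (i,j)\in\mathcal E_o\}$$ be the set of desired equilibria. Then the matrix $\mathcal F=R(\tilde p)^TR(\tilde p)+L_o\otimes I_d$ has a smallest positive eigenvalue $\gamma$, and there are constants $\delta>0$ and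 $C>0$ such that for every initial configuration $p_0\in\mathbb R^{dn}$ with $\|p_0-(\tilde p+\mathbf 1_n\otimes c)\|<\delta$ for some $c\in\mathbb R^d$ (in particular whenever $\|p_0-\tilde p\|<\delta$) the closed-loop system has a solution on $[0,\infty)$ with $p(0)=p_0$, and every such solution converges exponentially with rate $\gamma$ to a desired equilibrium with the shape and orientation of the target: there is $p^*\in\mathcal M$ of the form $p^*=\tilde p+\mathbf 1_n\otimes c^*$ with $c^*\in\mathbb R^d$ such that $$\|p(t)-p^*\|\le C\,\|p_0-p^*\|\,e^{-\gamma t}\qquad\text{for all }t\ge 0 .$$ -/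

import Mathlib

open scoped Kronecker

noncomputable section

namespace Formation

/-- A stacked configuration `p = [p₁ᵀ, …, pₙᵀ]ᵀ ∈ ℝ^{dn}` with its Euclidean norm; the entry
`(i, a)` is the `a`-th coordinate of agent `i`. -/
abbrev Config (n d : ℕ) : Type := EuclideanSpace ℝ (Fin n × Fin d)

/-- The position `p_i ∈ ℝ^d` of agent `i`. -/
def agent {n d : ℕ} (p : Config n d) (i : Fin n) : EuclideanSpace ℝ (Fin d) :=
  WithLp.toLp 2 fun a => p (i, a)

/-- The configuration `p + 1ₙ ⊗ c`, all agents being shifted by the same vector `c`. -/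
def translate {n d : ℕ} (p : Config n d) (c : EuclideanSpace ℝ (Fin d)) : Config n d :=
  WithLp.toLp 2 fun ia => p ia + c ia.2

/-- A numbering of the edges of the undirected graph `G` by `1, …, m`, each edge being given an
arbitrary direction from its tail to its head. -/
structure EdgeLabelling {n : ℕ} (G : SimpleGraph (Fin n)) (m : ℕ) where
  tail : Fin m → Fin n
  head : Fin m → Fin n
  bijOn : Set.BijOn (fun k => s(tail k, head k)) Set.univ G.edgeSet

section Shape

variable {n d m : ℕ} {G : SimpleGraph (Fin n)}

/-- The incidence matrix `H ∈ ℝ^{m×n}`. -/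
def incidence (E : EdgeLabelling G m) : Matrix (Fin m) (Fin n) ℝ :=
  Matrix.of fun k i => if i = E.head k then 1 else if i = E.tail k then -1 else 0

/-- The stacked relative positions `z = (H ⊗ I_d) p`, so that `z_k = p_{head k} - p_{tail k}`. -/
def relPos (E : EdgeLabelling G m) (p : Config n d) : Fin m × Fin d → ℝ :=
  (incidence E ⊗ₖ (1 : Matrix (Fin d) (Fin d) ℝ)).mulVec p.ofLp

/-- The block diagonal matrix `Z(z) = diag(z₁, …, z_m) ∈ ℝ^{dm×m}`. -/
def blockDiag (z : Fin m × Fin d → ℝ) : Matrix (Fin m × Fin d) (Fin m) ℝ :=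
  Matrix.of fun ka l => if ka.1 = l then z ka else 0

/-- The rigidity matrix `R(p) = Z(z)ᵀ (H ⊗ I_d) ∈ ℝ^{m×dn}`. -/
def rigidityMatrix (E : EdgeLabelling G m) (p : Config n d) :
    Matrix (Fin m) (Fin n × Fin d) ℝ :=
  (blockDiag (relPos E p)).transpose * (incidence E ⊗ₖ (1 : Matrix (Fin d) (Fin d) ℝ))

/-- Infinitesimal rigidity of the framework `(G, p)` in `ℝ^d`:
`n ≥ d` and `rank R(p) = dn - d(d+1)/2` (written without truncated subtraction). -/
def InfinitesimallyRigid (E : EdgeLabelling G m) (p : Config n d) : Prop :=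
  d ≤ n ∧ (rigidityMatrix E p).rank + d * (d + 1) / 2 = d * n

/-- The vector `e` of squared distance errors `e_k = ‖p_i - p_j‖² - d_k²`. -/
def distError (E : EdgeLabelling G m) (dist : Fin m → ℝ) (p : Config n d) : Fin m → ℝ :=
  fun k => ‖agent p (E.head k) - agent p (E.tail k)‖ ^ 2 - dist k ^ 2

end Shape

section Orientation

variable {n d m : ℕ} {G : SimpleGraph (Fin n)}

/-- The admissible choices of the orientation graph `Go`, relative to the positions `p`.
In the plane: one edge of `G`, with nonzero relative position vector.
In space: two edges of `G` at a common agent `i`, whose relative position vectors do not lie on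
one line (are linearly independent). -/
def IsOrientationChoice (G Go : SimpleGraph (Fin n)) (p : Config n d) : Prop :=
  (d = 2 ∧ ∃ i j, G.Adj i j ∧ agent p j - agent p i ≠ 0 ∧
    Go = SimpleGraph.fromEdgeSet {s(i, j)}) ∨
  (d = 3 ∧ ∃ i j k, G.Adj i j ∧ G.Adj i k ∧
    LinearIndependent ℝ ![agent p j - agent p i, agent p k - agent p i] ∧
    Go = SimpleGraph.fromEdgeSet {s(i, j), s(i, k)})

/-- `p` is a target formation: the distance constraints `‖p_i - p_j‖ = d_k` on all edges of `G`
and the orientation constraints `p_i - p_j = p̂_i - p̂_j` on all edges of `Go`. -/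
def IsTarget (E : EdgeLabelling G m) (Go : SimpleGraph (Fin n)) (dist : Fin m → ℝ)
    (pHat p : Config n d) : Prop :=
  (∀ k, ‖agent p (E.tail k) - agent p (E.head k)‖ = dist k) ∧
  ∀ i j, Go.Adj i j → agent p i - agent p j = agent pHat i - agent pHat j

/-- The set `M` of desired equilibria. -/
def desiredSet (E : EdgeLabelling G m) (Go : SimpleGraph (Fin n)) (dist : Fin m → ℝ)
    (pHat : Config n d) : Set (Config n d) :=
  {p | distError E dist p = 0 ∧
    ∀ i j, Go.Adj i j → agent p i - agent p j = agent pHat i - agent pHat j}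

/-- The vector `p̄`: `p̄_i = p_i - p̂_i` for orientation agents (the endpoints of edges of `Go`),
and `p̄_i = 0` for all other agents. -/
def pBar (Go : SimpleGraph (Fin n)) [DecidableRel Go.Adj] (pHat p : Config n d) :
    Fin n × Fin d → ℝ :=
  fun ia => if ∃ j, Go.Adj ia.1 j then p ia - pHat ia else 0

/-- The matrix `L_o ⊗ I_d`, with `L_o` the Laplacian matrix of `Go`. -/
def orientationMatrix (d : ℕ) (Go : SimpleGraph (Fin n)) [DecidableRel Go.Adj] :
    Matrix (Fin n × Fin d) (Fin n × Fin d) ℝ :=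
  Go.lapMatrix ℝ ⊗ₖ (1 : Matrix (Fin d) (Fin d) ℝ)

/-- The right-hand side `-R(p)ᵀ e(p) - (L_o ⊗ I_d) p̄` of the closed-loop system. -/
def closedLoop (E : EdgeLabelling G m) (Go : SimpleGraph (Fin n)) [DecidableRel Go.Adj]
    (dist : Fin m → ℝ) (pHat p : Config n d) : Config n d :=
  WithLp.toLp 2
    (-((rigidityMatrix E p).transpose.mulVec (distError E dist p))
      - (orientationMatrix d Go).mulVec (pBar Go pHat p))

/-- `p` is a solution on `[0, ∞)` of the closed-loop system with `p(0) = p₀`. -/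
def IsSolution (E : EdgeLabelling G m) (Go : SimpleGraph (Fin n)) [DecidableRel Go.Adj]
    (dist : Fin m → ℝ) (pHat p₀ : Config n d) (p : ℝ → Config n d) : Prop :=
  p 0 = p₀ ∧
  ∀ t ∈ Set.Ici (0 : ℝ),
    HasDerivWithinAt p (closedLoop E Go dist pHat (p t)) (Set.Ici 0) t

/-- The matrix `F = R(p)ᵀ R(p) + L_o ⊗ I_d`. -/
def matrixF (E : EdgeLabelling G m) (Go : SimpleGraph (Fin n)) [DecidableRel Go.Adj]
    (p : Config n d) : Matrix (Fin n × Fin d) (Fin n × Fin d) ℝ :=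
  (rigidityMatrix E p).transpose * rigidityMatrix E p + orientationMatrix d Go

/-- `γ` is the smallest positive eigenvalue of the square matrix `A`. -/
def IsSmallestPosEigenvalue {ι : Type*} [Fintype ι] [DecidableEq ι]
    (A : Matrix ι ι ℝ) (γ : ℝ) : Prop :=
  IsLeast {μ : ℝ | 0 < μ ∧ Module.End.HasEigenvalue (Matrix.toLin' A) μ} γ

end Orientation

end Formation

end

/-!
The kernel of `F = R(p̃)ᵀ R(p̃) + L_o ⊗ I_d` consists of the infinitesimal motions of `(G, p̃)` that
keep the relative positions along `Go` fixed. By rigidity the infinitesimal motions have dimension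
`d(d+1)/2`, and they contain the `d(d-1)/2`-dimensional space of infinitesimal rotations. A nonzero
skew-symmetric matrix cannot vanish on a subspace of codimension at most one, so no nonzero rotation
lies in the kernel of `L_o ⊗ I_d`; hence the kernel of `F` has dimension at most `d` and reduces to
the translations.

The closed loop preserves the centroid, so the error `x` from the nearest translate of `p̃` remains
orthogonal to the translations, where `F ≥ γ`. The cubic terms of `⟪x, ẋ⟫` are absorbed by
completing a square, which leaves `⟪x, ẋ⟫ ≤ -γ ‖x‖² + K ‖x‖⁴`. Comparing `‖x‖²` with a solution of a
logistic equation gives decay at the exact rate `γ`, and the same inequality confines solutions to a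
ball, outside of which the vector field can be cut off to obtain global existence.
-/

namespace Formation

open Matrix
open scoped RealInnerProductSpace

section IntegralCurves

open Set Filter Topology
open scoped Manifold

theorem exists_isIntegralCurve_of_hasCompactSupport {F : Type*} [NormedAddCommGroup F]
    [NormedSpace ℝ F] [CompleteSpace F] {v : F → F} (hv : ContDiff ℝ 1 v)
    (hc : HasCompactSupport v) (x₀ : F) :
    ∃ x : ℝ → F, x 0 = x₀ ∧ IsIntegralCurve x fun _ => v := by
  obtain ⟨K, hK⟩ := hv.lipschitzWith_of_hasCompactSupport hc one_ne_zero
  obtain ⟨L, hL⟩ := hc.exists_bound_of_continuous hv.continuous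
  have exists_Ioo : ∀ x₀ : F, ∃ x : ℝ → F, x 0 = x₀ ∧
      IsMIntegralCurveOn (I := 𝓘(ℝ, F)) x v (Ioo (-1) 1) := by
    intro x₀
    have hpl : IsPicardLindelof (fun _ => v) (tmin := -1) (tmax := 1) ⟨0, by simp⟩ x₀
        L.toNNReal 0 L.toNNReal K :=
      .of_time_independent (fun x _ => (hL x).trans L.le_coe_toNNReal) hK.lipschitzOnWith (by simp)
    obtain ⟨x, hx₀, hx⟩ := hpl.exists_eq_forall_mem_Icc_hasDerivWithinAt₀
    exact ⟨x, hx₀, fun t ht => ((hx t (Ioo_subset_Icc_self ht)).mono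
      Ioo_subset_Icc_self).hasFDerivWithinAt.hasMFDerivWithinAt⟩
  obtain ⟨x, hx₀, hx⟩ := exists_isMIntegralCurve_of_isMIntegralCurveOn
    (contMDiff_vectorSpace_iff_contDiff.mpr hv) one_pos exists_Ioo x₀
  refine ⟨x, hx₀, fun t => ?_⟩
  have hderiv : HasFDerivAt x ((1 : ℝ →L[ℝ] ℝ).smulRight (v (x t))) t :=
    hasMFDerivAt_iff_hasFDerivAt.mp (hx t)
  exact hderiv.hasDerivAt.congr_deriv (one_smul ℝ _)

variable {F : Type*} [NormedAddCommGroup F] [InnerProductSpace ℝ F] {v : F → F} {x : ℝ → F}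

theorem mem_of_isIntegralCurveOn {S : Submodule ℝ F} [S.HasOrthogonalProjection]
    (hx : IsIntegralCurveOn x (fun _ => v) (Ici 0)) (hv : ∀ y, v y ∈ S) (h₀ : x 0 ∈ S)
    {t : ℝ} (ht : 0 ≤ t) : x t ∈ S := by
  rw [← Submodule.orthogonal_orthogonal S, Submodule.mem_orthogonal]
  intro u hu
  have hderiv : ∀ s ∈ Ici (0 : ℝ), HasDerivWithinAt (fun s => ⟪u, x s⟫) 0 (Ici 0) s := by
    intro s hs
    simpa only [Submodule.inner_left_of_mem_orthogonal (hv _) hu, inner_zero_left, add_zero]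
      using (hasDerivWithinAt_const s (Ici 0) u).inner ℝ (hx s hs)
  have hconst : ⟪u, x t⟫ = ⟪u, x 0⟫ := constant_of_has_deriv_right_zero
    (fun s hs => (hderiv s hs.1).continuousWithinAt.mono Icc_subset_Ici_self)
    (fun s hs => (hderiv s hs.1).mono (Ici_subset_Ici.mpr hs.1)) t ⟨ht, le_rfl⟩
  exact hconst.trans (Submodule.inner_left_of_mem_orthogonal h₀ hu)

theorem norm_le_of_isIntegralCurveOn {r : ℝ} (hr : 0 ≤ r)
    (hx : IsIntegralCurveOn x (fun _ => v) (Ici 0))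
    (hin : ∀ t, 0 ≤ t → ‖x t‖ = r → ⟪x t, v (x t)⟫ < 0) (h₀ : ‖x 0‖ ≤ r)
    {t : ℝ} (ht : 0 ≤ t) : ‖x t‖ ≤ r := by
  have hsq : ‖x t‖ ^ 2 ≤ r ^ 2 := by
    refine image_le_of_deriv_right_lt_deriv_boundary (B' := fun _ => 0)
      (fun s hs => (hx s hs.1).norm_sq.continuousWithinAt.mono Icc_subset_Ici_self)
      (fun s hs => (hx s hs.1).norm_sq.mono (Ici_subset_Ici.mpr hs.1))
      (by gcongr) (fun s => hasDerivAt_const s (r ^ 2)) (fun s hs heq => ?_) ⟨ht, le_rfl⟩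
    have hnorm : ‖x s‖ = r := (sq_eq_sq₀ (norm_nonneg _) hr).mp heq
    linarith [hin s hs.1 hnorm]
  exact le_of_sq_le_sq hsq hr

theorem exists_isIntegralCurveOn_Ici [FiniteDimensional ℝ F] (hv : ContDiff ℝ 1 v)
    {S : Submodule ℝ F} (hS : ∀ y, v y ∈ S) {r : ℝ} (hr : 0 < r)
    (hin : ∀ y ∈ S, ‖y‖ = r → ⟪y, v y⟫ < 0) {x₀ : F} (hx₀ : x₀ ∈ S) (h₀ : ‖x₀‖ ≤ r) :
    ∃ x : ℝ → F, x 0 = x₀ ∧ IsIntegralCurveOn x (fun _ => v) (Ici 0) := by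
  let χ : ContDiffBump (0 : F) := ⟨r, r + 1, hr, lt_add_one r⟩
  let w : F → F := fun y => χ y • v y
  have hw : ∀ y, ‖y‖ ≤ r → w y = v y := by
    intro y hy
    simp only [w, χ.one_of_mem_closedBall (mem_closedBall_zero_iff.mpr hy), one_smul]
  obtain ⟨x, rfl, hx⟩ := exists_isIntegralCurve_of_hasCompactSupport (χ.contDiff.smul hv)
    χ.hasCompactSupport.smul_right x₀
  have hx' : IsIntegralCurveOn x (fun _ => w) (Ici 0) := hx.isIntegralCurveOn _
  have hmem : ∀ t, 0 ≤ t → x t ∈ S := fun t ht =>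
    mem_of_isIntegralCurveOn hx' (fun y => S.smul_mem _ (hS y)) hx₀ ht
  have hball : ∀ t, 0 ≤ t → ‖x t‖ ≤ r := fun t ht =>
    norm_le_of_isIntegralCurveOn hr.le hx'
      (fun s hs heq => (hw _ heq.le).symm ▸ hin _ (hmem s hs) heq) h₀ ht
  exact ⟨x, rfl, fun t ht => (hx' t ht).congr_deriv (hw _ (hball t ht))⟩

-- The barrier `2A / (e^{at} + 1)` solves `B' = -a B + (a / 2A) B²` with `B 0 = A`.
theorem le_div_exp_add_one_of_deriv_le {V V' : ℝ → ℝ} {a b A : ℝ}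
    (hV : ∀ t ∈ Ici (0 : ℝ), HasDerivWithinAt V (V' t) (Ici 0) t)
    (hV' : ∀ t ∈ Ici (0 : ℝ), V' t ≤ -a * V t + b * V t ^ 2)
    (hA : 0 < A) (h₀ : V 0 ≤ A) (hab : 2 * b * A < a) {t : ℝ} (ht : 0 ≤ t) :
    V t ≤ 2 * A / (Real.exp (a * t) + 1) := by
  let B : ℝ → ℝ := fun s => 2 * A / (Real.exp (a * s) + 1)
  have hB : ∀ s, HasDerivAt B (-a * B s + a / (2 * A) * B s ^ 2) s := by
    intro s
    have hexp : HasDerivAt (fun s => Real.exp (a * s) + 1) (Real.exp (a * s) * a) s := by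
      simpa only [mul_one, id_eq] using (((hasDerivAt_id s).const_mul a).exp.add_const 1)
    have hpos : Real.exp (a * s) + 1 ≠ 0 := by positivity
    refine ((hasDerivAt_const s (2 * A)).div hexp hpos).congr_deriv ?_
    simp only [B]
    field_simp
    ring
  refine image_le_of_deriv_right_lt_deriv_boundary
    (fun s hs => (hV s hs.1).continuousWithinAt.mono Icc_subset_Ici_self)
    (fun s hs => (hV s hs.1).mono (Ici_subset_Ici.mpr hs.1)) ?_ hB (fun s hs heq => ?_)
    ⟨ht, le_rfl⟩
  · simpa [B, show (1 : ℝ) + 1 = 2 by norm_num] using h₀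
  · have : 0 < B s := by positivity
    have hb : b < a / (2 * A) := by rw [lt_div_iff₀ (by positivity)]; linarith
    calc V' s ≤ -a * B s + b * B s ^ 2 := heq ▸ hV' s hs.1
      _ < -a * B s + a / (2 * A) * B s ^ 2 := by gcongr

theorem le_two_mul_exp_of_deriv_le {V V' : ℝ → ℝ} {a b : ℝ}
    (hV : ∀ t ∈ Ici (0 : ℝ), HasDerivWithinAt V (V' t) (Ici 0) t)
    (hV' : ∀ t ∈ Ici (0 : ℝ), V' t ≤ -a * V t + b * V t ^ 2)
    (h₀ : 0 ≤ V 0) (hab : 2 * b * V 0 < a) {t : ℝ} (ht : 0 ≤ t) :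
    V t ≤ 2 * V 0 * Real.exp (-a * t) := by
  have hlim : Tendsto (fun A => 2 * A * Real.exp (-a * t)) (𝓝[>] V 0)
      (𝓝 (2 * V 0 * Real.exp (-a * t))) :=
    Continuous.tendsto' (by fun_prop) _ _ rfl |>.mono_left nhdsWithin_le_nhds
  have hsmall : ∀ᶠ A in 𝓝[>] V 0, 2 * b * A < a :=
    nhdsWithin_le_nhds (ContinuousAt.eventually_lt (by fun_prop) continuousAt_const hab)
  refine ge_of_tendsto hlim ?_
  filter_upwards [hsmall, self_mem_nhdsWithin] with A hbA hA
  have hA₀ : 0 < A := h₀.trans_lt hA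
  calc V t ≤ 2 * A / (Real.exp (a * t) + 1) :=
        le_div_exp_add_one_of_deriv_le hV hV' hA₀ (le_of_lt hA) hbA ht
    _ ≤ 2 * A / Real.exp (a * t) := by gcongr; linarith
    _ = 2 * A * Real.exp (-a * t) := by rw [neg_mul, Real.exp_neg, div_eq_mul_inv]

theorem norm_le_sqrt_two_mul_exp_of_inner_le {γ K : ℝ}
    (hx : IsIntegralCurveOn x (fun _ => v) (Ici 0))
    (hin : ∀ t, 0 ≤ t → ⟪x t, v (x t)⟫ ≤ -γ * ‖x t‖ ^ 2 + K * ‖x t‖ ^ 4)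
    (h₀ : 2 * K * ‖x 0‖ ^ 2 < γ) {t : ℝ} (ht : 0 ≤ t) :
    ‖x t‖ ≤ √2 * ‖x 0‖ * Real.exp (-γ * t) := by
  have hsq : ‖x t‖ ^ 2 ≤ 2 * ‖x 0‖ ^ 2 * Real.exp (-(2 * γ) * t) :=
    le_two_mul_exp_of_deriv_le (b := 2 * K) (fun s hs => (hx s hs).norm_sq)
      (fun s hs => by linarith [hin s hs]) (by positivity) (by linarith) ht
  refine le_of_sq_le_sq (hsq.trans_eq ?_) (by positivity)
  rw [mul_pow, mul_pow, Real.sq_sqrt zero_le_two, ← Real.exp_nat_mul]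
  congr 2
  push_cast
  ring

end IntegralCurves

section MulVec

theorem kronecker_one_mulVec {ι κ μ S : Type*} [Fintype κ] [Fintype μ] [DecidableEq μ]
    [NonAssocSemiring S] (A : Matrix ι κ S) (v : κ × μ → S) (i : ι) (a : μ) :
    ((A ⊗ₖ (1 : Matrix μ μ S)) *ᵥ v) (i, a) = (A *ᵥ fun j => v (j, a)) i := by
  simp [mulVec, dotProduct, Fintype.sum_prod_type, kroneckerMap_apply, one_apply]

variable {ι κ : Type*} [Fintype ι] [Fintype κ]

theorem dotProduct_transpose_mul_self_add_mulVec {S : Type*} [CommSemiring S] (R : Matrix κ ι S)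
    (L : Matrix ι ι S) (v : ι → S) :
    v ⬝ᵥ (Rᵀ * R + L) *ᵥ v = (R *ᵥ v) ⬝ᵥ (R *ᵥ v) + v ⬝ᵥ L *ᵥ v := by
  rw [add_mulVec, dotProduct_add, ← mulVec_mulVec, dotProduct_mulVec, vecMul_transpose]

theorem transpose_mul_self_add_mulVec_eq_zero_iff {R : Matrix κ ι ℝ} {L : Matrix ι ι ℝ}
    (hL : L.PosSemidef) {v : ι → ℝ} :
    (Rᵀ * R + L) *ᵥ v = 0 ↔ R *ᵥ v = 0 ∧ L *ᵥ v = 0 := by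
  refine ⟨fun h => ?_, fun ⟨hRv, hLv⟩ => ?_⟩
  · have hR_nonneg : 0 ≤ (R *ᵥ v) ⬝ᵥ (R *ᵥ v) := dotProduct_star_self_nonneg _
    have hL_nonneg : 0 ≤ v ⬝ᵥ L *ᵥ v := by
      simpa only [star_trivial] using hL.dotProduct_mulVec_nonneg v
    have hsum := dotProduct_transpose_mul_self_add_mulVec R L v
    rw [h, dotProduct_zero] at hsum
    rw [← dotProduct_self_eq_zero, ← hL.dotProduct_mulVec_zero_iff, star_trivial]
    constructor <;> linarith
  · rw [add_mulVec, ← mulVec_mulVec, hRv, hLv, mulVec_zero, add_zero]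

end MulVec

section Eigenvalues

variable {ι : Type*} [Fintype ι] [DecidableEq ι] {A : Matrix ι ι ℝ}

theorem inner_toEuclideanLin (A : Matrix ι ι ℝ) (x y : EuclideanSpace ℝ ι) :
    ⟪x, toEuclideanLin A y⟫ = x.ofLp ⬝ᵥ A *ᵥ y.ofLp := by
  rw [EuclideanSpace.inner_eq_star_dotProduct, star_trivial, dotProduct_comm,
    ofLp_toLpLin, toLin'_apply]

theorem mem_ker_toEuclideanLin {κ : Type*} {A : Matrix κ ι ℝ}
    {x : EuclideanSpace ℝ ι} : x ∈ LinearMap.ker (toEuclideanLin A) ↔ A *ᵥ x.ofLp = 0 := by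
  rw [LinearMap.mem_ker, toLpLin_apply, WithLp.toLp_eq_zero]

theorem hasEigenvalue_eigenvalues (hA : A.IsHermitian) (i : ι) :
    Module.End.HasEigenvalue (toLin' A) (hA.eigenvalues i) := by
  rw [Module.End.hasEigenvalue_iff_mem_spectrum, spectrum_toLin']
  exact hA.eigenvalues_mem_spectrum_real i

theorem toEuclideanLin_eigenvectorBasis (hA : A.IsHermitian) (i : ι) :
    toEuclideanLin A (hA.eigenvectorBasis i) = hA.eigenvalues i • hA.eigenvectorBasis i := by
  ext j
  exact congrFun (hA.mulVec_eigenvectorBasis i) j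

theorem inner_toEuclideanLin_self (hA : A.IsHermitian) (x : EuclideanSpace ℝ ι) :
    ⟪x, toEuclideanLin A x⟫ = ∑ i, hA.eigenvalues i * ⟪hA.eigenvectorBasis i, x⟫ ^ 2 := by
  rw [← hA.eigenvectorBasis.sum_inner_mul_inner]
  refine Finset.sum_congr rfl fun i _ => ?_
  rw [← isSymmetric_toEuclideanLin_iff.mpr hA, toEuclideanLin_eigenvectorBasis,
    real_inner_smul_left, real_inner_comm]
  ring

theorem exists_isSmallestPosEigenvalue (hA : A.PosSemidef) (hne : A ≠ 0) :
    ∃ γ, IsSmallestPosEigenvalue A γ := by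
  have hfin : {μ : ℝ | 0 < μ ∧ Module.End.HasEigenvalue (toLin' A) μ}.Finite :=
    (Module.End.finite_hasEigenvalue _).subset fun _ => And.right
  obtain ⟨i, hi⟩ : ∃ i, hA.isHermitian.eigenvalues i ≠ 0 := by
    contrapose! hne
    exact hA.isHermitian.eigenvalues_eq_zero_iff.mp (funext hne)
  obtain ⟨γ, hγ⟩ := Set.exists_min_image _ id hfin
    ⟨_, (hA.eigenvalues_nonneg i).lt_of_ne' hi, hasEigenvalue_eigenvalues _ i⟩
  exact ⟨γ, hγ⟩

theorem IsSmallestPosEigenvalue.mul_norm_sq_le {γ : ℝ} (hA : A.PosSemidef)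
    (hγ : IsSmallestPosEigenvalue A γ) {x : EuclideanSpace ℝ ι}
    (hx : x ∈ (LinearMap.ker (toEuclideanLin A))ᗮ) :
    γ * ‖x‖ ^ 2 ≤ ⟪x, toEuclideanLin A x⟫ := by
  have hH := hA.isHermitian
  rw [inner_toEuclideanLin_self hH, ← hH.eigenvectorBasis.sum_sq_inner_right x, Finset.mul_sum]
  refine Finset.sum_le_sum fun i _ => ?_
  rcases (hA.eigenvalues_nonneg i).eq_or_lt with hzero | hpos
  · have hker : hH.eigenvectorBasis i ∈ LinearMap.ker (toEuclideanLin A) := by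
      rw [LinearMap.mem_ker, toEuclideanLin_eigenvectorBasis, ← hzero, zero_smul]
    rw [Submodule.inner_right_of_mem_orthogonal hker hx]
    simp
  · gcongr
    exact hγ.2 ⟨hpos, hasEigenvalue_eigenvalues hH i⟩

end Eigenvalues

section SkewSymmetric

variable {ι K : Type*} [Fintype ι] [DecidableEq ι]

theorem mem_skewAdjointMatricesSubmodule_one [CommRing K] {A : Matrix ι ι K} :
    A ∈ skewAdjointMatricesSubmodule (1 : Matrix ι ι K) ↔ Aᵀ = -A := by
  rw [mem_skewAdjointMatricesSubmodule, Matrix.IsSkewAdjoint, Matrix.IsAdjointPair, mul_one,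
    one_mul]

variable (ι K) in
theorem finrank_skewAdjointMatricesSubmodule_one [Field K] [NeZero (2 : K)] :
    Module.finrank K (skewAdjointMatricesSubmodule (1 : Matrix ι ι K)) =
      (Fintype.card ι).choose 2 := by
  let symmetrize : Matrix ι ι K →ₗ[K] Sym2 ι → K :=
    { toFun A := Sym2.lift ⟨fun i j => A i j + A j i, fun _ _ => add_comm _ _⟩
      map_add' A B := funext <| Sym2.ind fun i j => add_add_add_comm _ _ _ _
      map_smul' c A := funext <| Sym2.ind fun i j => (mul_add _ _ _).symm }
  have hsurj : LinearMap.range symmetrize = ⊤ := by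
    refine LinearMap.range_eq_top.mpr fun f => ⟨of fun i j => f s(i, j) / 2, ?_⟩
    refine funext <| Sym2.ind fun i j => ?_
    simp only [symmetrize, LinearMap.coe_mk, AddHom.coe_mk, Sym2.lift_mk, of_apply,
      Sym2.eq_swap (a := j), add_halves]
  have hker : LinearMap.ker symmetrize = skewAdjointMatricesSubmodule 1 := by
    ext A
    rw [LinearMap.mem_ker, mem_skewAdjointMatricesSubmodule_one, funext_iff, Sym2.forall,
      ← Matrix.ext_iff]
    exact forall₂_congr fun i j => add_eq_zero_iff_eq_neg'
  have hcount := symmetrize.finrank_range_add_finrank_ker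
  rw [hsurj, hker, finrank_top, Module.finrank_fintype_fun_eq_card, Module.finrank_matrix,
    Module.finrank_self, Sym2.card] at hcount
  have hpascal := Nat.choose_succ_succ' (Fintype.card ι) 1
  have htriangle := Nat.add_one_mul_choose_eq (Fintype.card ι) 1
  rw [Nat.choose_one_right] at hpascal htriangle
  linarith

theorem eq_zero_of_inner_self_eq_zero_of_finrank_le {F : Type*} [NormedAddCommGroup F]
    [InnerProductSpace ℝ F] [FiniteDimensional ℝ F] {B : F →ₗ[ℝ] F} (hB : ∀ x, ⟪x, B x⟫ = 0)
    (hker : Module.finrank ℝ F ≤ Module.finrank ℝ (LinearMap.ker B) + 1) : B = 0 := by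
  have hskew : ∀ x y, ⟪B x, y⟫ = -⟪x, B y⟫ := by
    intro x y
    have hxy := hB (x + y)
    simp only [map_add, inner_add_left, inner_add_right, hB, zero_add, add_zero] at hxy
    rw [real_inner_comm, eq_neg_of_add_eq_zero_left hxy]
  have hrank : Module.finrank ℝ (LinearMap.range B) ≤ 1 := by
    have := B.finrank_range_add_finrank_ker
    lia
  obtain ⟨⟨y, x, rfl⟩, hy⟩ := finrank_le_one_iff.mp hrank
  obtain ⟨c, hc⟩ := hy ⟨B (B x), B x, rfl⟩
  replace hc : c • B x = B (B x) := congrArg Subtype.val hc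
  have hBB : B (B x) = 0 := by
    rw [← inner_self_eq_zero (𝕜 := ℝ), ← hc, real_inner_smul_left, hc, hB, mul_zero]
  have hBx : B x = 0 := by
    rw [← inner_self_eq_zero (𝕜 := ℝ), hskew, hBB, inner_zero_right, neg_zero]
  ext z
  obtain ⟨b, hb⟩ := hy ⟨B z, z, rfl⟩
  replace hb : b • B x = B z := congrArg Subtype.val hb
  rw [LinearMap.zero_apply, ← hb, hBx, smul_zero]

end SkewSymmetric

section Framework

variable {n d m : ℕ} {G : SimpleGraph (Fin n)}

@[simp]
theorem agent_apply (p : Config n d) (i : Fin n) (a : Fin d) : agent p i a = p (i, a) := rfl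

@[simp]
theorem agent_add (p q : Config n d) (i : Fin n) : agent (p + q) i = agent p i + agent q i := rfl

@[simp]
theorem agent_sub (p q : Config n d) (i : Fin n) : agent (p - q) i = agent p i - agent q i := rfl

@[simp]
theorem agent_translate (p : Config n d) (c : EuclideanSpace ℝ (Fin d)) (i : Fin n) :
    agent (translate p c) i = agent p i + c := rfl

theorem norm_agent_le (p : Config n d) (i : Fin n) : ‖agent p i‖ ≤ ‖p‖ := by
  refine le_of_sq_le_sq ?_ (norm_nonneg p)
  rw [EuclideanSpace.norm_sq_eq, EuclideanSpace.norm_sq_eq, Fintype.sum_prod_type]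
  exact Finset.single_le_sum (f := fun i => ∑ a, ‖p (i, a)‖ ^ 2)
    (fun _ _ => Finset.sum_nonneg fun _ _ => sq_nonneg _) (Finset.mem_univ i)

variable (E : EdgeLabelling G m)

theorem EdgeLabelling.tail_ne_head (k : Fin m) : E.tail k ≠ E.head k :=
  SimpleGraph.Adj.ne (E.bijOn.mapsTo (Set.mem_univ k))

/-- The relative position `z_k ∈ ℝ^d` along the `k`-th edge, i.e. the `k`-th block of the stacked
vector `relPos`. -/
def edgeVec (p : Config n d) (k : Fin m) : EuclideanSpace ℝ (Fin d) :=
  agent p (E.head k) - agent p (E.tail k)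

@[simp]
theorem edgeVec_add (p q : Config n d) (k : Fin m) :
    edgeVec E (p + q) k = edgeVec E p k + edgeVec E q k := by
  simp only [edgeVec, agent_add]
  abel

@[simp]
theorem edgeVec_translate (p : Config n d) (c : EuclideanSpace ℝ (Fin d)) (k : Fin m) :
    edgeVec E (translate p c) k = edgeVec E p k := by
  simp only [edgeVec, agent_translate, add_sub_add_right_eq_sub]

theorem norm_edgeVec_le (p : Config n d) (k : Fin m) : ‖edgeVec E p k‖ ≤ 2 * ‖p‖ :=
  calc ‖edgeVec E p k‖ ≤ ‖agent p (E.head k)‖ + ‖agent p (E.tail k)‖ := norm_sub_le _ _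
    _ ≤ ‖p‖ + ‖p‖ := add_le_add (norm_agent_le p _) (norm_agent_le p _)
    _ = 2 * ‖p‖ := (two_mul _).symm

/-- The infinitesimal motions of the framework `(G, p)`: the velocities that preserve all edge
lengths to first order. -/
noncomputable def infinitesimalMotions (p : Config n d) : Submodule ℝ (Config n d) :=
  LinearMap.ker (toEuclideanLin (rigidityMatrix E p))

theorem incidence_mulVec (v : Fin n → ℝ) (k : Fin m) :
    (incidence E *ᵥ v) k = v (E.head k) - v (E.tail k) := by
  have hrow : incidence E k = Pi.single (E.head k) 1 - Pi.single (E.tail k) 1 := by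
    ext i
    by_cases hi : i = E.head k
    · simp [incidence, hi, (E.tail_ne_head k).symm]
    · simp [incidence, hi, Pi.single_apply, apply_ite (fun c : ℝ => -c)]
  rw [mulVec, hrow, sub_dotProduct, single_one_dotProduct, single_one_dotProduct]

theorem kronecker_incidence_mulVec (p : Config n d) (k : Fin m) (a : Fin d) :
    ((incidence E ⊗ₖ (1 : Matrix (Fin d) (Fin d) ℝ)) *ᵥ p.ofLp) (k, a) = edgeVec E p k a := by
  rw [kronecker_one_mulVec, incidence_mulVec]
  rfl

theorem rigidityMatrix_mulVec (p x : Config n d) (k : Fin m) :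
    (rigidityMatrix E p *ᵥ x.ofLp) k = ⟪edgeVec E p k, edgeVec E x k⟫ := by
  rw [rigidityMatrix, ← mulVec_mulVec, mulVec, dotProduct, Fintype.sum_prod_type]
  simp only [transpose_apply, blockDiag, of_apply, ite_mul, zero_mul, relPos,
    kronecker_incidence_mulVec]
  rw [Finset.sum_comm]
  simp only [Finset.sum_ite_eq', Finset.mem_univ, if_true, PiLp.inner_apply, RCLike.inner_apply,
    conj_trivial, mul_comm]

variable (d) (Go : SimpleGraph (Fin n)) [DecidableRel Go.Adj]

theorem posSemidef_orientationMatrix : (orientationMatrix d Go).PosSemidef :=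
  (Go.posSemidef_lapMatrix ℝ).kronecker .one

variable {d}

theorem orientationMatrix_mulVec_eq_zero_iff {x : Config n d} :
    orientationMatrix d Go *ᵥ x.ofLp = 0 ↔ ∀ i j, Go.Adj i j → agent x i = agent x j := by
  have hcoord : orientationMatrix d Go *ᵥ x.ofLp = 0 ↔
      ∀ a, Go.lapMatrix ℝ *ᵥ (fun j => x (j, a)) = 0 := by
    simp only [funext_iff, Prod.forall, orientationMatrix, kronecker_one_mulVec, Pi.zero_apply]
    exact forall_comm
  simp only [hcoord, SimpleGraph.lapMatrix_mulVec_eq_zero_iff_forall_adj, PiLp.ext_iff,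
    agent_apply]
  exact ⟨fun h i j hij a => h a i j hij, fun h a i j hij => h i j hij a⟩

-- The masked entries belong to vertices isolated in `Go`, where the Laplacian vanishes.
theorem orientationMatrix_mulVec_pBar (pHat p : Config n d) :
    orientationMatrix d Go *ᵥ pBar Go pHat p = orientationMatrix d Go *ᵥ (p - pHat).ofLp := by
  rw [← sub_eq_zero, ← mulVec_sub, ← WithLp.ofLp_toLp 2 (pBar Go pHat p), ← WithLp.ofLp_sub,
    orientationMatrix_mulVec_eq_zero_iff]
  intro i j hij
  ext a
  simp [pBar, show ∃ l, Go.Adj i l from ⟨j, hij⟩, show ∃ l, Go.Adj j l from ⟨i, hij.symm⟩]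

theorem posSemidef_matrixF (p : Config n d) : (matrixF E Go p).PosSemidef := by
  refine .add ?_ (posSemidef_orientationMatrix d Go)
  rw [← conjTranspose_eq_transpose_of_trivial]
  exact posSemidef_conjTranspose_mul_self _

theorem inner_matrixF (p x : Config n d) :
    ⟪x, toEuclideanLin (matrixF E Go p) x⟫ =
      ∑ k, ⟪edgeVec E p k, edgeVec E x k⟫ ^ 2 +
        ⟪x, toEuclideanLin (orientationMatrix d Go) x⟫ := by
  rw [inner_toEuclideanLin, inner_toEuclideanLin, matrixF, dotProduct_transpose_mul_self_add_mulVec]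
  simp only [dotProduct, rigidityMatrix_mulVec, sq]

variable {E Go}

theorem mem_infinitesimalMotions {p x : Config n d} :
    x ∈ infinitesimalMotions E p ↔ ∀ k, ⟪edgeVec E p k, edgeVec E x k⟫ = 0 := by
  simp only [infinitesimalMotions, mem_ker_toEuclideanLin, funext_iff, rigidityMatrix_mulVec,
    Pi.zero_apply]

theorem mem_ker_orientationMatrix {x : Config n d} :
    x ∈ LinearMap.ker (toEuclideanLin (orientationMatrix d Go)) ↔
      ∀ i j, Go.Adj i j → agent x i = agent x j := by
  rw [mem_ker_toEuclideanLin, orientationMatrix_mulVec_eq_zero_iff]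

theorem ker_matrixF (p : Config n d) :
    LinearMap.ker (toEuclideanLin (matrixF E Go p)) =
      infinitesimalMotions E p ⊓ LinearMap.ker (toEuclideanLin (orientationMatrix d Go)) := by
  ext x
  simp only [infinitesimalMotions, Submodule.mem_inf, mem_ker_toEuclideanLin, matrixF,
    transpose_mul_self_add_mulVec_eq_zero_iff (posSemidef_orientationMatrix d Go)]

end Framework

section Translations

variable {n d m : ℕ} {G : SimpleGraph (Fin n)} {E : EdgeLabelling G m} {Go : SimpleGraph (Fin n)}
  [DecidableRel Go.Adj]

/-- The linear map `c ↦ 1ₙ ⊗ c`. -/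
def translation (n d : ℕ) : EuclideanSpace ℝ (Fin d) →ₗ[ℝ] Config n d where
  toFun c := WithLp.toLp 2 fun ia => c ia.2
  map_add' _ _ := rfl
  map_smul' _ _ := rfl

/-- The configurations `1ₙ ⊗ c`, i.e. the velocities of the rigid translations. -/
def translations (n d : ℕ) : Submodule ℝ (Config n d) :=
  LinearMap.range (translation n d)

@[simp]
theorem agent_translation (c : EuclideanSpace ℝ (Fin d)) (i : Fin n) :
    agent (translation n d c) i = c := rfl

theorem translate_eq_add (p : Config n d) (c : EuclideanSpace ℝ (Fin d)) :
    translate p c = p + translation n d c := rfl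

theorem edgeVec_translation (c : EuclideanSpace ℝ (Fin d)) (k : Fin m) :
    edgeVec E (translation n d c) k = 0 := by
  simp only [edgeVec, agent_translation, sub_self]

theorem finrank_translations (hn : 0 < n) : Module.finrank ℝ (translations n d) = d := by
  have hinj : Function.Injective (translation n d) := fun c c' h =>
    congrArg (fun x => agent x ⟨0, hn⟩) h
  rw [translations, LinearMap.finrank_range_of_inj hinj, finrank_euclideanSpace_fin]

theorem translations_le_infinitesimalMotions (p : Config n d) :
    translations n d ≤ infinitesimalMotions E p := by
  rintro _ ⟨c, rfl⟩
  exact mem_infinitesimalMotions.mpr fun k => by rw [edgeVec_translation, inner_zero_right]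

theorem translations_le_ker_orientationMatrix :
    translations n d ≤ LinearMap.ker (toEuclideanLin (orientationMatrix d Go)) := by
  rintro _ ⟨c, rfl⟩
  exact mem_ker_orientationMatrix.mpr fun _ _ _ => rfl

end Translations

section Rotations

variable {n d m : ℕ} {G : SimpleGraph (Fin n)} {E : EdgeLabelling G m} {Go : SimpleGraph (Fin n)}
  {p : Config n d}

/-- The infinitesimal rotation `(A p₁, …, A pₙ)` of the configuration `p`, for a skew-symmetric
matrix `A`. -/
noncomputable def rotation (p : Config n d) :
    skewAdjointMatricesSubmodule (1 : Matrix (Fin d) (Fin d) ℝ) →ₗ[ℝ] Config n d where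
  toFun A := WithLp.toLp 2 fun ia => toEuclideanLin A.1 (agent p ia.1) ia.2
  map_add' A B := by ext; simp
  map_smul' r A := by ext; simp

theorem agent_rotation (A : skewAdjointMatricesSubmodule (1 : Matrix (Fin d) (Fin d) ℝ))
    (i : Fin n) : agent (rotation p A) i = toEuclideanLin A.1 (agent p i) := rfl

/-- The span of the relative positions `p_j - p_i` along the orientation edges. It has codimension
at most one exactly when no nonzero infinitesimal rotation fixes all these relative positions. -/
def orientationSpan (Go : SimpleGraph (Fin n)) (p : Config n d) :
    Submodule ℝ (EuclideanSpace ℝ (Fin d)) :=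
  Submodule.span ℝ {z | ∃ i j, Go.Adj i j ∧ z = agent p j - agent p i}

theorem sub_mem_orientationSpan {i j : Fin n} (hij : Go.Adj i j) :
    agent p j - agent p i ∈ orientationSpan Go p :=
  Submodule.subset_span ⟨i, j, hij, rfl⟩

theorem inner_skewAdjointMatrix_self
    (A : skewAdjointMatricesSubmodule (1 : Matrix (Fin d) (Fin d) ℝ))
    (x : EuclideanSpace ℝ (Fin d)) : ⟪x, toEuclideanLin A.1 x⟫ = 0 := by
  have hA : A.1ᵀ = -A.1 := mem_skewAdjointMatricesSubmodule_one.mp A.2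
  have hneg : x.ofLp ⬝ᵥ A.1 *ᵥ x.ofLp = -(x.ofLp ⬝ᵥ A.1 *ᵥ x.ofLp) := by
    conv_lhs => rw [dotProduct_mulVec, ← mulVec_transpose, hA, neg_mulVec, neg_dotProduct,
      dotProduct_comm]
  rw [inner_toEuclideanLin]
  linarith

theorem range_rotation_le_infinitesimalMotions :
    LinearMap.range (rotation p) ≤ infinitesimalMotions E p := by
  rintro _ ⟨A, rfl⟩
  refine mem_infinitesimalMotions.mpr fun k => ?_
  rw [edgeVec, edgeVec, agent_rotation, agent_rotation, ← map_sub, inner_skewAdjointMatrix_self]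

theorem eq_zero_of_forall_adj_agent_rotation_eq
    (hspan : d ≤ Module.finrank ℝ (orientationSpan Go p) + 1)
    {A : skewAdjointMatricesSubmodule (1 : Matrix (Fin d) (Fin d) ℝ)}
    (hA : ∀ i j, Go.Adj i j → agent (rotation p A) i = agent (rotation p A) j) : A = 0 := by
  have hker : orientationSpan Go p ≤ LinearMap.ker (toEuclideanLin A.1) := by
    refine Submodule.span_le.mpr ?_
    rintro _ ⟨i, j, hij, rfl⟩
    rw [SetLike.mem_coe, LinearMap.mem_ker, map_sub, ← agent_rotation, ← agent_rotation,
      hA i j hij, sub_self]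
  have hzero : toEuclideanLin A.1 = 0 := by
    refine eq_zero_of_inner_self_eq_zero_of_finrank_le (inner_skewAdjointMatrix_self A) ?_
    rw [finrank_euclideanSpace_fin]
    exact hspan.trans (Nat.add_le_add_right (Submodule.finrank_mono hker) 1)
  exact Subtype.ext (toEuclideanLin.map_eq_zero_iff.mp hzero)

theorem finrank_range_rotation (hspan : d ≤ Module.finrank ℝ (orientationSpan Go p) + 1) :
    Module.finrank ℝ (LinearMap.range (rotation p)) = d.choose 2 := by
  have hinj : Function.Injective (rotation p) :=
    (injective_iff_map_eq_zero _).mpr fun A hA =>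
      eq_zero_of_forall_adj_agent_rotation_eq hspan fun _ _ _ => by rw [hA]; rfl
  rw [LinearMap.finrank_range_of_inj hinj, finrank_skewAdjointMatricesSubmodule_one,
    Fintype.card_fin]

theorem finrank_infinitesimalMotions (hrigid : InfinitesimallyRigid E p) :
    Module.finrank ℝ (infinitesimalMotions E p) = (d + 1).choose 2 := by
  have hnullity := (toEuclideanLin (rigidityMatrix E p)).finrank_range_add_finrank_ker
  have hrank := rank_eq_finrank_range_toLin (rigidityMatrix E p)
    (PiLp.basisFun 2 ℝ (Fin m)) (PiLp.basisFun 2 ℝ (Fin n × Fin d))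
  rw [← toLpLin_eq_toLin] at hrank
  rw [← hrank, finrank_euclideanSpace, Fintype.card_prod, Fintype.card_fin, Fintype.card_fin,
    mul_comm n d, ← hrigid.2, mul_comm d] at hnullity
  rw [Nat.choose_two_right]
  exact Nat.add_left_cancel hnullity

variable [DecidableRel Go.Adj]

-- The rotations take up `d.choose 2` of the `(d + 1).choose 2` dimensions of infinitesimal motions.
theorem finrank_infinitesimalMotions_inf_ker_orientationMatrix_le
    (hrigid : InfinitesimallyRigid E p)
    (hspan : d ≤ Module.finrank ℝ (orientationSpan Go p) + 1) :
    Module.finrank ℝ (infinitesimalMotions E p ⊓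
      LinearMap.ker (toEuclideanLin (orientationMatrix d Go)) : Submodule ℝ (Config n d)) ≤ d := by
  have hdisj : Disjoint (LinearMap.range (rotation p))
      (infinitesimalMotions E p ⊓ LinearMap.ker (toEuclideanLin (orientationMatrix d Go))) := by
    rw [Submodule.disjoint_def]
    rintro _ ⟨A, rfl⟩ ⟨-, hA⟩
    rw [eq_zero_of_forall_adj_agent_rotation_eq hspan (mem_ker_orientationMatrix.mp hA), map_zero]
  have hle := Submodule.finrank_mono
    (sup_le (range_rotation_le_infinitesimalMotions (E := E) (p := p)) (inf_le_left
      (b := LinearMap.ker (toEuclideanLin (orientationMatrix d Go)))))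
  have hsum := Submodule.finrank_sup_add_finrank_inf_eq (LinearMap.range (rotation p))
    (infinitesimalMotions E p ⊓ LinearMap.ker (toEuclideanLin (orientationMatrix d Go)))
  rw [hdisj.eq_bot, finrank_bot, add_zero, finrank_range_rotation hspan] at hsum
  rw [hsum, finrank_infinitesimalMotions hrigid, Nat.choose_succ_succ', Nat.choose_one_right,
    add_comm] at hle
  exact Nat.le_of_add_le_add_right hle

theorem ker_matrixF_eq_translations (hn : 0 < n) (hrigid : InfinitesimallyRigid E p)
    (hspan : d ≤ Module.finrank ℝ (orientationSpan Go p) + 1) :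
    LinearMap.ker (toEuclideanLin (matrixF E Go p)) = translations n d := by
  rw [ker_matrixF]
  refine (Submodule.eq_of_le_of_finrank_le (le_inf (translations_le_infinitesimalMotions p)
    translations_le_ker_orientationMatrix) ?_).symm
  rw [finrank_translations hn]
  exact finrank_infinitesimalMotions_inf_ker_orientationMatrix_le hrigid hspan

theorem matrixF_ne_zero (hd : 0 < d) (hn : 1 < n) (hrigid : InfinitesimallyRigid E p)
    (hspan : d ≤ Module.finrank ℝ (orientationSpan Go p) + 1) : matrixF E Go p ≠ 0 := by
  intro hzero
  have hfinrank := finrank_translations (d := d) (zero_lt_one.trans hn)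
  rw [← ker_matrixF_eq_translations (zero_lt_one.trans hn) hrigid hspan, hzero, map_zero,
    LinearMap.ker_zero, finrank_top, finrank_euclideanSpace, Fintype.card_prod, Fintype.card_fin,
    Fintype.card_fin] at hfinrank
  exact (Nat.mul_lt_mul_of_pos_right hn hd).ne' (by rw [hfinrank, one_mul])

end Rotations

section OrientationChoice

variable {n d : ℕ} {G Go : SimpleGraph (Fin n)} {p : Config n d}

theorem IsOrientationChoice.one_lt (h : IsOrientationChoice G Go p) : 1 < d := by
  rcases h with ⟨rfl, -⟩ | ⟨rfl, -⟩ <;> norm_num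

theorem IsOrientationChoice.le_finrank_orientationSpan_add_one (h : IsOrientationChoice G Go p) :
    d ≤ Module.finrank ℝ (orientationSpan Go p) + 1 := by
  rcases h with ⟨rfl, i, j, hij, hne, rfl⟩ | ⟨rfl, i, j, k, hij, hik, hindep, rfl⟩
  · have hmem : agent p j - agent p i ∈ orientationSpan (.fromEdgeSet {s(i, j)}) p :=
      sub_mem_orientationSpan (by simp [hij.ne])
    have hnontrivial : Nontrivial (orientationSpan (.fromEdgeSet {s(i, j)}) p) :=
      Submodule.nontrivial_iff_ne_bot.mpr (Submodule.ne_bot_iff _ |>.mpr ⟨_, hmem, hne⟩)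
    exact Nat.add_le_add_right Module.finrank_pos 1
  · have hle : Submodule.span ℝ (Set.range ![agent p j - agent p i, agent p k - agent p i]) ≤
        orientationSpan (.fromEdgeSet {s(i, j), s(i, k)}) p := by
      rw [Submodule.span_le, range_cons_cons_empty, Set.pair_subset_iff]
      exact ⟨sub_mem_orientationSpan (by simp [hij.ne]),
        sub_mem_orientationSpan (by simp [hik.ne])⟩
    have hrank := Submodule.finrank_mono hle
    rw [finrank_span_eq_card hindep, Fintype.card_fin] at hrank
    exact Nat.add_le_add_right hrank 1

end OrientationChoice

theorem sq_inner_sub_le_inner_add_mul_norm_sq_sub {F : Type*} [NormedAddCommGroup F]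
    [InnerProductSpace ℝ F] (z w : F) :
    ⟪z, w⟫ ^ 2 - 5 / 4 * ‖w‖ ^ 4 ≤ ⟪z + w, w⟫ * (‖z + w‖ ^ 2 - ‖z‖ ^ 2) := by
  have hsquare : ⟪z + w, w⟫ * (‖z + w‖ ^ 2 - ‖z‖ ^ 2) - (⟪z, w⟫ ^ 2 - 5 / 4 * ‖w‖ ^ 4) =
      (⟪z, w⟫ + 3 / 2 * ‖w‖ ^ 2) ^ 2 := by
    rw [inner_add_left, real_inner_self_eq_norm_sq, norm_add_sq_real]
    ring
  exact sub_nonneg.mp (hsquare ▸ sq_nonneg _)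

section ClosedLoop

variable {n d m : ℕ} {G : SimpleGraph (Fin n)} {E : EdgeLabelling G m} {Go : SimpleGraph (Fin n)}
  {dist : Fin m → ℝ} {pHat pTilde p₀ q : Config n d}

theorem IsTarget.distError_eq (h : IsTarget E Go dist pHat pTilde) (p : Config n d) (k : Fin m) :
    distError E dist p k = ‖edgeVec E p k‖ ^ 2 - ‖edgeVec E pTilde k‖ ^ 2 := by
  rw [distError, ← h.1 k, norm_sub_rev (agent pTilde _)]
  rfl

theorem IsTarget.translate_mem_desiredSet (h : IsTarget E Go dist pHat pTilde)
    (c : EuclideanSpace ℝ (Fin d)) : translate pTilde c ∈ desiredSet E Go dist pHat := by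
  refine ⟨funext fun k => ?_, fun i j hij => ?_⟩
  · rw [h.distError_eq, edgeVec_translate, sub_self, Pi.zero_apply]
  · rw [agent_translate, agent_translate, add_sub_add_right_eq_sub, h.2 i j hij]

theorem exists_sub_translate_mem_orthogonal (p p₀ : Config n d) (c : EuclideanSpace ℝ (Fin d)) :
    ∃ c', p₀ - translate p c' ∈ (translations n d)ᗮ ∧
      ‖p₀ - translate p c'‖ ≤ ‖p₀ - translate p c‖ := by
  obtain ⟨b, hb⟩ : (translations n d).starProjection (p₀ - translate p c) ∈ translations n d :=
    Submodule.starProjection_apply_mem _ _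
  have hproj : p₀ - translate p (c + b) =
      (p₀ - translate p c) - (translations n d).starProjection (p₀ - translate p c) := by
    rw [← hb, translate_eq_add, translate_eq_add, map_add]
    abel
  refine ⟨c + b, hproj ▸ Submodule.sub_starProjection_mem_orthogonal _, ?_⟩
  rw [hproj, ← Submodule.starProjection_orthogonal_val]
  exact Submodule.norm_starProjection_apply_le _ _

variable [DecidableRel Go.Adj]

variable (E) in
theorem contDiff_rigidityMatrix_apply (k : Fin m) (ia : Fin n × Fin d) :
    ContDiff ℝ 1 fun p : Config n d => rigidityMatrix E p k ia := by
  have happly : ∀ p : Config n d, rigidityMatrix E p k ia =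
      ⟪edgeVec E p k, edgeVec E (EuclideanSpace.single ia 1) k⟫ := by
    intro p
    rw [← rigidityMatrix_mulVec, PiLp.ofLp_single, mulVec_single_one]
    rfl
  simp only [happly, edgeVec, PiLp.inner_apply, PiLp.sub_apply, agent_apply,
    RCLike.inner_apply, conj_trivial]
  fun_prop

variable (E Go) in
theorem contDiff_closedLoop (dist : Fin m → ℝ) (pHat : Config n d) :
    ContDiff ℝ 1 (closedLoop E Go dist pHat) := by
  rw [contDiff_euclidean]
  intro ia
  simp only [closedLoop, orientationMatrix_mulVec_pBar, Pi.sub_apply, Pi.neg_apply, mulVec,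
    dotProduct, transpose_apply, WithLp.ofLp_sub]
  refine ContDiff.sub (ContDiff.neg <| ContDiff.sum fun k _ => ?_) (by fun_prop)
  refine (contDiff_rigidityMatrix_apply E k ia).mul ?_
  simp only [distError, EuclideanSpace.norm_sq_eq, PiLp.sub_apply, agent_apply, Real.norm_eq_abs,
    sq_abs]
  fun_prop

variable (E Go) in
theorem inner_closedLoop (dist : Fin m → ℝ) (pHat p x : Config n d) :
    ⟪x, closedLoop E Go dist pHat p⟫ =
      -∑ k, ⟪edgeVec E p k, edgeVec E x k⟫ * distError E dist p k -
        ⟪x, toEuclideanLin (orientationMatrix d Go) (p - pHat)⟫ := by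
  rw [inner_toEuclideanLin, EuclideanSpace.inner_eq_star_dotProduct, star_trivial,
    dotProduct_comm, closedLoop, orientationMatrix_mulVec_pBar, dotProduct_sub, dotProduct_neg,
    dotProduct_mulVec, vecMul_transpose]
  simp only [dotProduct, rigidityMatrix_mulVec]

variable (E Go) in
theorem closedLoop_mem_orthogonal_translations (dist : Fin m → ℝ) (pHat p : Config n d) :
    closedLoop E Go dist pHat p ∈ (translations n d)ᗮ := by
  rw [Submodule.mem_orthogonal]
  rintro _ ⟨c, rfl⟩
  have hker : toEuclideanLin (orientationMatrix d Go) (translation n d c) = 0 :=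
    translations_le_ker_orientationMatrix ⟨c, rfl⟩
  have hsymm := isSymmetric_toEuclideanLin_iff.mpr (posSemidef_orientationMatrix d Go).isHermitian
  rw [inner_closedLoop, ← hsymm, hker, inner_zero_left]
  simp only [edgeVec_translation, inner_zero_right, zero_mul, Finset.sum_const_zero, neg_zero,
    sub_zero]

theorem IsTarget.inner_closedLoop_le (h : IsTarget E Go dist pHat pTilde)
    (c : EuclideanSpace ℝ (Fin d)) (x : Config n d) :
    ⟪x, closedLoop E Go dist pHat (translate pTilde c + x)⟫ ≤
      -⟪x, toEuclideanLin (matrixF E Go pTilde) x⟫ + 20 * m * ‖x‖ ^ 4 := by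
  have horient : toEuclideanLin (orientationMatrix d Go) (translate pTilde c + x - pHat) =
      toEuclideanLin (orientationMatrix d Go) x := by
    have hker : translate pTilde c - pHat ∈
        LinearMap.ker (toEuclideanLin (orientationMatrix d Go)) :=
      mem_ker_orientationMatrix.mpr fun i j hij => by
        simpa [sub_eq_sub_iff_sub_eq_sub] using h.2 i j hij
    rw [add_sub_right_comm, map_add, LinearMap.mem_ker.mp hker, zero_add]
  have hedge : ∀ k, ⟪edgeVec E pTilde k, edgeVec E x k⟫ ^ 2 - 20 * ‖x‖ ^ 4 ≤
      ⟪edgeVec E (translate pTilde c + x) k, edgeVec E x k⟫ *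
        distError E dist (translate pTilde c + x) k := by
    intro k
    rw [h.distError_eq, edgeVec_add, edgeVec_translate]
    have hnorm : ‖edgeVec E x k‖ ^ 4 ≤ (2 * ‖x‖) ^ 4 := by
      gcongr
      exact norm_edgeVec_le E x k
    linarith [sq_inner_sub_le_inner_add_mul_norm_sq_sub (edgeVec E pTilde k) (edgeVec E x k)]
  have hsum := Finset.sum_le_sum fun k (_ : k ∈ Finset.univ) => hedge k
  rw [Finset.sum_sub_distrib, Finset.sum_const, Finset.card_univ, Fintype.card_fin,
    nsmul_eq_mul] at hsum
  rw [inner_closedLoop, horient, inner_matrixF]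
  linarith

theorem IsTarget.inner_closedLoop_le_of_isSmallestPosEigenvalue {γ : ℝ}
    (h : IsTarget E Go dist pHat pTilde) (hn : 0 < n) (hrigid : InfinitesimallyRigid E pTilde)
    (hspan : d ≤ Module.finrank ℝ (orientationSpan Go pTilde) + 1)
    (hγ : IsSmallestPosEigenvalue (matrixF E Go pTilde) γ) (c : EuclideanSpace ℝ (Fin d))
    {x : Config n d} (hx : x ∈ (translations n d)ᗮ) :
    ⟪x, closedLoop E Go dist pHat (translate pTilde c + x)⟫ ≤
      -γ * ‖x‖ ^ 2 + 20 * m * ‖x‖ ^ 4 := by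
  rw [← ker_matrixF_eq_translations hn hrigid hspan] at hx
  linarith [h.inner_closedLoop_le c x, hγ.mul_norm_sq_le (posSemidef_matrixF E Go pTilde) hx]

theorem isSolution_iff_isIntegralCurveOn_sub {p : ℝ → Config n d} (q : Config n d) :
    IsSolution E Go dist pHat p₀ p ↔ p 0 = p₀ ∧ IsIntegralCurveOn (fun t => p t - q)
      (fun _ x => closedLoop E Go dist pHat (q + x)) (Set.Ici 0) := by
  simp only [IsSolution, IsIntegralCurveOn, hasDerivWithinAt_sub_const_iff, add_sub_cancel]

theorem exists_isSolution {γ K r : ℝ}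
    (hin : ∀ x ∈ (translations n d)ᗮ,
      ⟪x, closedLoop E Go dist pHat (q + x)⟫ ≤ -γ * ‖x‖ ^ 2 + K * ‖x‖ ^ 4)
    (hr : 0 < r) (hK : K * r ^ 2 < γ)
    (hmem : p₀ - q ∈ (translations n d)ᗮ) (h₀ : ‖p₀ - q‖ ≤ r) :
    ∃ p, IsSolution E Go dist pHat p₀ p := by
  have hv : ContDiff ℝ 1 fun x => closedLoop E Go dist pHat (q + x) :=
    (contDiff_closedLoop E Go dist pHat).comp (contDiff_const.add contDiff_id)
  have hinward : ∀ y ∈ (translations n d)ᗮ, ‖y‖ = r →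
      ⟪y, closedLoop E Go dist pHat (q + y)⟫ < 0 := fun y hy hyr =>
    calc ⟪y, closedLoop E Go dist pHat (q + y)⟫ ≤ -γ * r ^ 2 + K * r ^ 4 := hyr ▸ hin y hy
      _ = (K * r ^ 2 - γ) * r ^ 2 := by ring
      _ < 0 := mul_neg_of_neg_of_pos (sub_neg.mpr hK) (by positivity)
  obtain ⟨x, hx₀, hx⟩ := exists_isIntegralCurveOn_Ici hv
    (fun _ => closedLoop_mem_orthogonal_translations E Go dist pHat _) hr hinward hmem h₀
  refine ⟨fun t => q + x t, (isSolution_iff_isIntegralCurveOn_sub q).mpr ⟨?_, ?_⟩⟩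
  · rw [hx₀, add_sub_cancel]
  · simpa only [add_sub_cancel_left] using hx

theorem IsSolution.norm_sub_le {γ K : ℝ} {p : ℝ → Config n d}
    (hp : IsSolution E Go dist pHat p₀ p)
    (hin : ∀ x ∈ (translations n d)ᗮ,
      ⟪x, closedLoop E Go dist pHat (q + x)⟫ ≤ -γ * ‖x‖ ^ 2 + K * ‖x‖ ^ 4)
    (hmem : p₀ - q ∈ (translations n d)ᗮ) (h₀ : 2 * K * ‖p₀ - q‖ ^ 2 < γ)
    {t : ℝ} (ht : 0 ≤ t) : ‖p t - q‖ ≤ √2 * ‖p₀ - q‖ * Real.exp (-γ * t) := by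
  obtain ⟨rfl, hx⟩ := (isSolution_iff_isIntegralCurveOn_sub q).mp hp
  exact norm_le_sqrt_two_mul_exp_of_inner_le hx (fun s hs => hin _ <| mem_of_isIntegralCurveOn hx
    (fun _ => closedLoop_mem_orthogonal_translations E Go dist pHat _) hmem hs) h₀ ht

end ClosedLoop

end Formation

open Formation in
theorem theorem3_general {n d m : ℕ} {G : SimpleGraph (Fin n)} (E : EdgeLabelling G m)
    (Go : SimpleGraph (Fin n)) [DecidableRel Go.Adj] (dist : Fin m → ℝ) (pHat pTilde : Config n d)
    (hd : 0 < d) (hn : 1 < n) (hTarget : IsTarget E Go dist pHat pTilde)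
    (hRigid : InfinitesimallyRigid E pTilde)
    (hSpan : d ≤ Module.finrank ℝ (orientationSpan Go pTilde) + 1) :
    ∃ γ : ℝ, IsSmallestPosEigenvalue (matrixF E Go pTilde) γ ∧
      ∃ δ > (0 : ℝ), ∃ C > (0 : ℝ), ∀ p₀ : Config n d,
        (∃ c : EuclideanSpace ℝ (Fin d), ‖p₀ - translate pTilde c‖ < δ) →
          (∃ p : ℝ → Config n d, IsSolution E Go dist pHat p₀ p) ∧
          ∀ p : ℝ → Config n d, IsSolution E Go dist pHat p₀ p →
            ∃ pStar ∈ desiredSet E Go dist pHat,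
              (∃ c : EuclideanSpace ℝ (Fin d), pStar = translate pTilde c) ∧
              ∀ t : ℝ, 0 ≤ t → ‖p t - pStar‖ ≤ C * ‖p₀ - pStar‖ * Real.exp (-γ * t) := by
  obtain ⟨γ, hγ⟩ := exists_isSmallestPosEigenvalue (posSemidef_matrixF E Go pTilde)
    (matrixF_ne_zero hd hn hRigid hSpan)
  obtain ⟨ε, hε, hKε⟩ := exists_pos_mul_lt hγ.1.1 (2 * (20 * m))
  refine ⟨γ, hγ, √ε, Real.sqrt_pos.mpr hε, √2, by positivity, ?_⟩
  rintro p₀ ⟨c₀, hc₀⟩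
  obtain ⟨c, hmem, hle⟩ := exists_sub_translate_mem_orthogonal pTilde p₀ c₀
  have hin := fun x => hTarget.inner_closedLoop_le_of_isSmallestPosEigenvalue (x := x)
    (zero_lt_one.trans hn) hRigid hSpan hγ c
  have hnear : ‖p₀ - translate pTilde c‖ ≤ √ε := hle.trans hc₀.le
  have hsq : ‖p₀ - translate pTilde c‖ ^ 2 ≤ ε := (Real.le_sqrt (norm_nonneg _) hε.le).mp hnear
  refine ⟨exists_isSolution hin (Real.sqrt_pos.mpr hε) ?_ hmem hnear, fun p hp =>
    ⟨_, hTarget.translate_mem_desiredSet c, ⟨c, rfl⟩, fun t ht => hp.norm_sub_le hin hmem ?_ ht⟩⟩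
  · rw [Real.sq_sqrt hε.le]
    linarith [hγ.1.1]
  · exact (by gcongr : _ ≤ 2 * (20 * m) * ε).trans_lt hKε

theorem theorem3 {n d m : ℕ} {G : SimpleGraph (Fin n)} (E : Formation.EdgeLabelling G m)
    (Go : SimpleGraph (Fin n)) [DecidableRel Go.Adj]
    (dist : Fin m → ℝ) (pHat pTilde : Formation.Config n d)
    (hTarget : Formation.IsTarget E Go dist pHat pTilde)
    (hRigid : Formation.InfinitesimallyRigid E pTilde)
    (hOrient : Formation.IsOrientationChoice G Go pTilde) :
    ∃ γ : ℝ, Formation.IsSmallestPosEigenvalue (Formation.matrixF E Go pTilde) γ ∧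
      ∃ δ > (0 : ℝ), ∃ C > (0 : ℝ), ∀ p₀ : Formation.Config n d,
        (∃ c : EuclideanSpace ℝ (Fin d), ‖p₀ - Formation.translate pTilde c‖ < δ) →
          (∃ p : ℝ → Formation.Config n d, Formation.IsSolution E Go dist pHat p₀ p) ∧
          ∀ p : ℝ → Formation.Config n d, Formation.IsSolution E Go dist pHat p₀ p →
            ∃ pStar ∈ Formation.desiredSet E Go dist pHat,
              (∃ c : EuclideanSpace ℝ (Fin d), pStar = Formation.translate pTilde c) ∧
              ∀ t : ℝ, 0 ≤ t →
                ‖p t - pStar‖ ≤ C * ‖p₀ - pStar‖ * Real.exp (-γ * t) :=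
  theorem3_general E Go dist pHat pTilde (zero_lt_one.trans hOrient.one_lt)
    (hOrient.one_lt.trans_le hRigid.1) hTarget hRigid hOrient.le_finrank_orientationSpan_add_one
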